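/- All graphs are finite, simple, connected and undirected; $N[v]$ is the closed neighborhood of $v$ and $\langle U\rangle$ the subgraph induced by $U$. A graph is *thin* if distinct vertices have distinct closed neighborhoods. For $U\subseteq V(G)$ put $S_U(x)=\{w\in U: N[w]\cap U=N[x]\cap U\}$; an edge $(a,b)$ of $\langle U\rangle$ satisfies the *S1-condition* in $\langle U\rangle$ if $|S_U(a)|=1$ or $|S_U(b)|=1$. The *backbone* of $G$ is $\mathbb B(G)=\{v: |S_{N[v]}(v)|=1\}$. A prime factor decomposition (PFD) is a coordinatization of a graph as a strong product of prime graphs; an edge is *Cartesian*, of the $k$-th factor, if its endpoints differ exactly in the $k$-th coordinate. The *partial product coloring* $P_v$ of $\langle N[v]\rangle$ induced by a PFD of $\langle N[v]\rangle$ colors exactly those Cartesian edges of $\langle N[v]\rangle$ that satisfy the S1-condition in $\langle N[v]\rangle$, each with the index of its factor (if $\langle N[v]\rangle$ is thin, these are all its Cartesian edges). Let $f$ and $g$ be colorings of some of the edges of $G$. *Color-continuation from $f$ to $g$ fails for* a color $c$ of $g$ if no edge of $g$-color $c$ is colored by $f$; $g$ is a *color-continuation* of $f$ if it fails for no color of $g$.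 The *combined coloring* of $f$ and $g$ uses the colors of $f$ on the edges colored by $f$ and those of $g$ on the remaining edges colored by $g$, where a color of $f$ and a color of $g$ that occur on a common edge are identified. For a set $W$ of vertices and a PFD of $G$, a partial edge coloring is a *proper combined coloring* of the $P_w$, $w\in W$, if 1. the colored edges are exactly the edges colored by some $P_w$, $w\in W$; 2. edges with the same $P_w$-color, for some $w\in W$, have the same color; 3. it is at least as fine as the product coloring of $G$: every colored edge is Cartesian in $G$, and edges of the same color belong to the same prime factor of $G$. **Lemma.** Let $G$ be a thin graph, with a PFD of $G$ and of each $\langle N[v]\rangle$, and let $v_1,\dots,v_n$ be a breadth-first-search ordering of its backbone (in $\langle\mathbb B(G)\rangle$). Let $v_i$ be a vertex of this list that has a parent $x$, that is, $x$ is the first vertex of the list adjacent to $v_i$, and it precedes $v_i$. Assume that $\langle N[v_i]\rangle$ and $\langle N[x]\rangle$ are thin. Let $H=\langle\bigcup_{j<i}N[v_j]\rangle$ carry a proper combined coloring $f$ of $P_{v_1},\dots,P_{v_{i-1}}$, and let $C$ be the set of colors of $P_{v_i}$ for which color-continuation from $f$ to $P_{v_i}$ fails. Consider the following algorithm. - For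 every $c\in C$ choose a representative edge $e_c=(x,w)$ with $P_{v_i}(e_c)=c$. Let $D_c$ be the set of those colors $k$ of $f$ such that $x$ and $w$ differ in the coordinate $k$, where $\langle N[x]\rangle$ is coordinatized with respect to $f$: the coordinate $k$ comprises all coordinates of the PFD of $\langle N[x]\rangle$ whose factor has $f$-color $k$. - For every $c\in C$ merge all colors in $D_c$ to one color. Every $e_c$ now is Cartesian in $\langle N[x]\rangle$ with respect to the merged coordinates, and it receives the merged color. Call the resulting coloring $f'$. - Output the combined coloring of $f'$ and $P_{v_i}$. Then every $c\in C$ has a representative $e_c$ as required, and for every choice of representatives $P_{v_i}$ is a color-continuation of $f'$ and the output is a proper combined coloring of $P_{v_1},\dots,P_{v_i}$, i.e. of $H$ and $\langle N[v_i]\rangle$. -/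

import Mathlib

universe u v

namespace StrongPFD

/-! ### Neighbourhoods, thinness, S-classes, backbone -/

section Basic

variable {V : Type u}

/-- The closed neighbourhood `N[v]`. -/
def closedNbhd (G : SimpleGraph V) (v : V) : Set V := insert v (G.neighborSet v)

theorem self_mem_closedNbhd (G : SimpleGraph V) (v : V) : v ∈ closedNbhd G v :=
  Set.mem_insert v _

/-- The induced subgraph `⟨N[v]⟩`. -/
abbrev nbhdGraph (G : SimpleGraph V) (v : V) : SimpleGraph (closedNbhd G v) :=
  G.induce (closedNbhd G v)

/-- A graph is thin if distinct vertices have distinct closed neighbourhoods. -/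
def IsThin (G : SimpleGraph V) : Prop :=
  ∀ x y : V, closedNbhd G x = closedNbhd G y → x = y

/-- The class `S_H(x)` for the induced subgraph `H = ⟨U⟩` of `G`. -/
def sClass (G : SimpleGraph V) (U : Set V) (x : V) : Set V :=
  {w | w ∈ U ∧ closedNbhd G w ∩ U = closedNbhd G x ∩ U}

/-- The backbone: all vertices `w` with `|S_w(w)| = 1`. -/
def backbone (G : SimpleGraph V) : Set V :=
  {w | (sClass G (closedNbhd G w) w).ncard = 1}

end Basic

/-! ### Strong products and prime factor decompositions -/

/-- The strong product of two graphs. -/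
def strongProd {A : Type u} {B : Type v} (G : SimpleGraph A) (H : SimpleGraph B) :
    SimpleGraph (A × B) where
  Adj x y := x ≠ y ∧ (x.1 = y.1 ∨ G.Adj x.1 y.1) ∧ (x.2 = y.2 ∨ H.Adj x.2 y.2)
  symm := ⟨fun _ _ h => ⟨h.1.symm, h.2.1.imp Eq.symm (fun t => t.symm),
    h.2.2.imp Eq.symm (fun t => t.symm)⟩⟩
  loopless := ⟨fun _ h => h.1 rfl⟩

/-- The strong product of a family of graphs. -/
def strongProdFamily {ι : Type v} {W : ι → Type u} (G : ∀ i, SimpleGraph (W i)) :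
    SimpleGraph (∀ i, W i) where
  Adj x y := x ≠ y ∧ ∀ i, x i = y i ∨ (G i).Adj (x i) (y i)
  symm := ⟨fun _ _ h => ⟨h.1.symm, fun i => (h.2 i).imp Eq.symm (fun t => t.symm)⟩⟩
  loopless := ⟨fun _ h => h.1 rfl⟩

/-- A nontrivial graph is prime (with respect to the strong product) if it is not the strong
product of two nontrivial graphs. -/
def IsPrimeGraph {W : Type u} (G : SimpleGraph W) : Prop :=
  Nontrivial W ∧
    ∀ (A B : Type u) (GA : SimpleGraph A) (GB : SimpleGraph B),
      Nonempty (G ≃g strongProd GA GB) → Subsingleton A ∨ Subsingleton B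

/-- A prime factor decomposition of `G` with respect to the strong product, together with the
coordinatization of `G` that it provides. (The one-vertex graph has the empty decomposition.) -/
structure PFD {W : Type u} (G : SimpleGraph W) where
  n : ℕ
  Factor : Fin n → Type u
  graph : ∀ i, SimpleGraph (Factor i)
  prime : ∀ i, IsPrimeGraph (graph i)
  iso : G ≃g strongProdFamily graph

/-- `e` is an edge of `G` whose endpoints differ in exactly the `i`-th coordinate, that is, a
Cartesian edge lying in a fiber of the `i`-th factor. -/
def PFD.IsCartesian {W : Type u} {G : SimpleGraph W} (p : PFD G) (e : Sym2 W) (i : Fin p.n) :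
    Prop :=
  ∃ a b : W, e = s(a, b) ∧ G.Adj a b ∧ ∀ j, p.iso a j ≠ p.iso b j ↔ j = i

/-! ### Colorings

A (partial) edge coloring of a subgraph of `G` is a map `Sym2 V → Option κ`;
the value `none` means that the pair is not colored. -/

section Coloring

variable {V : Type u}

/-- `e` is an edge of the induced subgraph `⟨U⟩` that satisfies the S1-condition in `⟨U⟩` and
that is Cartesian, with color (index of a factor) `i`, for the decomposition `p` of `⟨U⟩`. -/
def HasLocalColor (G : SimpleGraph V) {U : Set V} (p : PFD (G.induce U)) (e : Sym2 V)
    (i : Fin p.n) : Prop :=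
  ∃ a b : U, e = s((a : V), (b : V)) ∧ p.IsCartesian s(a, b) i ∧
    ((sClass G U a).ncard = 1 ∨ (sClass G U b).ncard = 1)

theorem PFD.IsCartesian.unique {W : Type u} {G : SimpleGraph W} {p : PFD G} {e : Sym2 W}
    {i j : Fin p.n} (hi : p.IsCartesian e i) (hj : p.IsCartesian e j) : i = j := by
  obtain ⟨a, b, rfl, -, h⟩ := hi
  obtain ⟨a', b', he, -, h'⟩ := hj
  rcases Sym2.eq_iff.1 he with ⟨rfl, rfl⟩ | ⟨rfl, rfl⟩
  · exact (h' i).1 ((h i).2 rfl)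
  · exact (h' i).1 (((h i).2 rfl).symm)

theorem HasLocalColor.unique {G : SimpleGraph V} {U : Set V} {p : PFD (G.induce U)} {e : Sym2 V}
    {i j : Fin p.n} (hi : HasLocalColor G p e i) (hj : HasLocalColor G p e j) : i = j := by
  obtain ⟨a, b, rfl, h, -⟩ := hi
  obtain ⟨a', b', he, h', -⟩ := hj
  have hs : s(a, b) = s(a', b') := by
    rcases Sym2.eq_iff.1 he with ⟨h1, h2⟩ | ⟨h1, h2⟩
    · rw [Subtype.ext h1, Subtype.ext h2]
    · rw [Subtype.ext h1, Subtype.ext h2, Sym2.eq_swap]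
  exact h.unique (hs ▸ h')

open Classical in
/-- The partial product coloring of `⟨U⟩` induced by the decomposition `p`: exactly the Cartesian
edges of `⟨U⟩` that satisfy the S1-condition in `⟨U⟩` are colored, each with the index of its
factor. If `⟨U⟩` is thin, these are all Cartesian edges of `⟨U⟩`. -/
noncomputable def localColoring (G : SimpleGraph V) {U : Set V} (p : PFD (G.induce U)) :
    Sym2 V → Option (Fin p.n) :=
  fun e => if h : ∃ i, HasLocalColor G p e i then some h.choose else none

theorem localColoring_eq_some_iff {G : SimpleGraph V} {U : Set V} {p : PFD (G.induce U)}
    {e : Sym2 V} {i : Fin p.n} : localColoring G p e = some i ↔ HasLocalColor G p e i := by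
  unfold localColoring
  constructor
  · intro h
    split_ifs at h with h0
    rw [← Option.some.inj h]
    exact h0.choose_spec
  · intro h
    have h0 : ∃ i, HasLocalColor G p e i := ⟨i, h⟩
    rw [dif_pos h0, h0.choose_spec.unique h]

/-- `g` is a color-continuation of `f`: every color in the image of `g` is the `g`-color of
some edge that is colored by `f`. -/
def IsColorContinuation {κ : Type*} {μ : Type*} (f : Sym2 V → Option κ) (g : Sym2 V → Option μ) :
    Prop :=
  ∀ c, (∃ e, g e = some c) → ∃ e, g e = some c ∧ f e ≠ none

/-- The set of colors of `g` for which the color-continuation from `f` to `g` fails. -/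
def failingColors {κ : Type*} {μ : Type*} (f : Sym2 V → Option κ) (g : Sym2 V → Option μ) :
    Set μ :=
  {c | (∃ e, g e = some c) ∧ ∀ e, g e = some c → f e = none}

/-- A color of `f` and a color of `g` are identified if some edge carries both of them. -/
inductive SharedColor {κ : Type*} {μ : Type*} (f : Sym2 V → Option κ) (g : Sym2 V → Option μ) :
    κ ⊕ μ → κ ⊕ μ → Prop
  | shared (e : Sym2 V) (k : κ) (c : μ) (hf : f e = some k) (hg : g e = some c) :
      SharedColor f g (Sum.inl k) (Sum.inr c)

/-- The combined coloring: the colors of `f` on the edges colored by `f`, the colors of `g` on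
the remaining edges colored by `g`, where colors represented on a common edge are identified
(`Quot` passes to the generated equivalence relation). -/
def combinedColoring {κ : Type*} {μ : Type*} (f : Sym2 V → Option κ) (g : Sym2 V → Option μ) :
    Sym2 V → Option (Quot (SharedColor f g)) :=
  fun e => match f e with
    | some k => some (Quot.mk _ (Sum.inl k))
    | none => (g e).map fun c => Quot.mk _ (Sum.inr c)

/-- A partial edge coloring `f` is a proper combined coloring of the partial product colorings
of the neighbourhoods `⟨N[w]⟩`, `w ∈ L`, given by the decompositions `P w`:
* an edge is colored iff it is colored in one of these neighbourhoods;
* edges with the same color in some `⟨N[w]⟩` get the same color, i.e. on the colored edges of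
  `⟨N[w]⟩` the coloring is the product coloring of a factorization obtained by merging factors;
* it is at least as fine as the product coloring of `G` given by its decomposition `q`:
  colored edges are Cartesian in `G`, and equally colored ones belong to the same factor. -/
structure IsProperCombined (G : SimpleGraph V) (q : PFD G) (P : ∀ w, PFD (nbhdGraph G w))
    (L : List V) {κ : Type*} (f : Sym2 V → Option κ) : Prop where
  domain : ∀ e, f e ≠ none ↔ ∃ w ∈ L, localColoring G (P w) e ≠ none
  compatible : ∀ w ∈ L, ∀ (e e' : Sym2 V) (c : Fin (P w).n),
    localColoring G (P w) e = some c → localColoring G (P w) e' = some c → f e = f e'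
  fine : ∀ (e e' : Sym2 V) (k : κ), f e = some k → f e' = some k →
    ∃ l, q.IsCartesian e l ∧ q.IsCartesian e' l

end Coloring

/-! ### Breadth-first search -/

section BFS

variable {V : Type u}

/-- States of a breadth-first search of the subgraph of `G` induced by `B`: the list built so far
and the number of its vertices already processed. Processing a vertex `a` appends all neighbours
of `a` that are not yet in the list, in any order. -/
inductive BFSState (G : SimpleGraph V) (B : Set V) : List V → ℕ → Prop
  | start (r : V) (hr : r ∈ B) : BFSState G B [r] 0
  | process (L : List V) (k : ℕ) (a : V) (A : List V) (h : BFSState G B L k)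
      (ha : L[k]? = some a) (hA : A.Nodup) (hmem : ∀ w, w ∈ A ↔ w ∈ B ∧ G.Adj a w ∧ w ∉ L) :
      BFSState G B (L ++ A) (k + 1)

/-- `L` is a BFS-ordering of `B`: the list of a search in which all vertices are processed. -/
def IsBFSOrder (G : SimpleGraph V) (B : Set V) (L : List V) : Prop :=
  BFSState G B L L.length

/-- `x` is the parent of the vertex in position `i` of the BFS-list `L`: the vertex by which it
was appended, i.e. the first vertex of the list adjacent to it, listed before it. -/
def IsBFSParent (G : SimpleGraph V) (L : List V) (i : ℕ) (hi : i < L.length) (x : V) : Prop :=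
  ∃ (k : ℕ) (hk : k < i), L[k] = x ∧ G.Adj x L[i] ∧
    ∀ (k' : ℕ) (hk' : k' < k), ¬ G.Adj L[k'] L[i]

end BFS

/-! ### The algorithm solving the color-continuation problem

Input: a partial edge coloring `f` of `H`, a coloring `g` of `⟨N[v]⟩`, a vertex `x` with a
decomposition `p` of `⟨N[x]⟩`, and a set `C` of colors of `g`. The function `rep` records the
representatives chosen by the algorithm: `e_c = (x, rep c)` for `c ∈ C`. -/

section Algorithm

variable {V : Type u} {κ : Type*} {μ : Type*}

/-- The set `D` of coordinates (colors) `k` in which `x` and `w` differ, where the coordinates of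
`⟨N[x]⟩` are taken with respect to `f`: the coordinate with index `k` consists of all
coordinates for `p` whose color is `k` in `f`. -/
def differingColors (G : SimpleGraph V) (f : Sym2 V → Option κ) (x : V)
    (p : PFD (nbhdGraph G x)) (w : V) : Set κ :=
  {k | ∃ (hw : w ∈ closedNbhd G x) (i : Fin p.n),
    p.iso ⟨x, self_mem_closedNbhd G x⟩ i ≠ p.iso ⟨w, hw⟩ i ∧
    ∃ e, localColoring G p e = some i ∧ f e = some k}

/-- Two colors of `f` are merged if both belong to the set `D` of some `c ∈ C`. -/
def MergedColors (G : SimpleGraph V) (f : Sym2 V → Option κ) (x : V) (p : PFD (nbhdGraph G x))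
    (C : Set μ) (rep : μ → V) (k k' : κ) : Prop :=
  ∃ c ∈ C, k ∈ differingColors G f x p (rep c) ∧ k' ∈ differingColors G f x p (rep c)

open Classical in
/-- The coloring of `H` after all merging steps: the colors of `f` are merged, and each
representative `e_c = (x, rep c)`, `c ∈ C`, whose endpoints now differ only in the merged
coordinate, is colored with the color into which its set `D` was merged. -/
noncomputable def mergedColoring (G : SimpleGraph V) (f : Sym2 V → Option κ) (x : V)
    (p : PFD (nbhdGraph G x)) (C : Set μ) (rep : μ → V) :
    Sym2 V → Option (Quot (MergedColors G f x p C rep)) :=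
  fun e => match f e with
    | some k => some (Quot.mk _ k)
    | none =>
      if h : ∃ k, ∃ c ∈ C, e = s(x, rep c) ∧ k ∈ differingColors G f x p (rep c) then
        some (Quot.mk _ h.choose)
      else none

/-- The output of the algorithm: the combined coloring of the merged coloring of `H` and `g`. -/
noncomputable def solveColorContinuation (G : SimpleGraph V) (f : Sym2 V → Option κ)
    (g : Sym2 V → Option μ) (x : V) (p : PFD (nbhdGraph G x)) (C : Set μ) (rep : μ → V) :
    Sym2 V → Option (Quot (SharedColor (mergedColoring G f x p C rep) g)) :=
  combinedColoring (mergedColoring G f x p C rep) g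

end Algorithm

end StrongPFD

/-! Everything rests on one fact: each color of `P_v`, for a thin `⟨N[v]⟩`, lies inside a single
factor of the PFD of `G`. Adjacency-or-equality in a strong product holds coordinatewise, so `N[v]`
is a subproduct of `G`, and the coordinates of `G` restrict to a second, possibly coarser
coordinatization of `⟨N[v]⟩`. In a thin graph with a universal vertex, such as the center `v`, every
prime factor of one coordinatization lies in a factor of any other
(`IsCoordinatization.exists_factor`).

This refinement is order-theoretic. Ordering vertices by reverse inclusion of closed neighborhoods
gives, by thinness, a partial order with the universal vertex `u` as least element. Projections onto
fibers through `u` are monotone and decreasing, so these fibers are down-sets. Hence a fiber of one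
splitting is the product of its intersections with the fibers of any other, and a prime fiber must
lie in one of them.

For the algorithm, representatives exist because every vertex of `N[v]` is on Cartesian edges of all
factors of `⟨N[v]⟩`. A representative `(x, w)` is Cartesian in `G`, say for the factor `l`. Each
factor of `⟨N[x]⟩` in whose coordinate `x` and `w` differ lies in a factor of `G` in whose
coordinate they differ, which is `l`. So only colors of one factor of `G` are merged. As `D_c` is
nonempty, `e_c` gets colored, which repairs the color-continuation. -/

namespace StrongPFD

/-! ### Strong products as direct products of reflexive relations -/

section Refinement

/-- The reflexive closure of the adjacency relation. -/
def AdjOrEq {W : Type*} (H : SimpleGraph W) (x y : W) : Prop := x = y ∨ H.Adj x y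

theorem AdjOrEq.refl {W : Type*} (H : SimpleGraph W) (x : W) : AdjOrEq H x x := Or.inl rfl

theorem AdjOrEq.symm {W : Type*} {H : SimpleGraph W} {x y : W} (h : AdjOrEq H x y) :
    AdjOrEq H y x :=
  h.imp Eq.symm fun t => t.symm

theorem adj_iff_ne_and_adjOrEq {W : Type*} {H : SimpleGraph W} {x y : W} :
    H.Adj x y ↔ x ≠ y ∧ AdjOrEq H x y :=
  ⟨fun h => ⟨h.ne, Or.inr h⟩, fun h => h.2.resolve_left h.1⟩

theorem mem_closedNbhd_iff {W : Type*} {H : SimpleGraph W} {x y : W} :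
    y ∈ closedNbhd H x ↔ AdjOrEq H x y := by
  simp [closedNbhd, AdjOrEq, eq_comm]

theorem IsThin.eq {W : Type*} {H : SimpleGraph W} (hH : IsThin H) {x y : W}
    (h : ∀ z, AdjOrEq H x z ↔ AdjOrEq H y z) : x = y :=
  hH x y (Set.ext fun z => by rw [mem_closedNbhd_iff, mem_closedNbhd_iff, h])

theorem adjOrEq_strongProdFamily {ι : Type*} {F : ι → Type*} {B : ∀ i, SimpleGraph (F i)}
    {x y : ∀ i, F i} :
    AdjOrEq (strongProdFamily B) x y ↔ ∀ i, AdjOrEq (B i) (x i) (y i) := by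
  constructor
  · rintro (rfl | h) i
    · exact .refl _ _
    · exact h.2 i
  · intro h
    by_cases hxy : x = y
    · exact Or.inl hxy
    · exact Or.inr ⟨hxy, h⟩

theorem adjOrEq_iso {W W' : Type*} {H : SimpleGraph W} {H' : SimpleGraph W'} (φ : H ≃g H')
    {x y : W} : AdjOrEq H x y ↔ AdjOrEq H' (φ x) (φ y) := by
  rw [AdjOrEq, AdjOrEq, φ.injective.eq_iff, φ.map_adj_iff]

theorem adjOrEq_induce {W : Type*} {H : SimpleGraph W} {U : Set W} {x y : U} :
    AdjOrEq (H.induce U) x y ↔ AdjOrEq H x y := by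
  simp [AdjOrEq, Subtype.ext_iff]

/-- A coordinatization of `H`: an embedding into the strong product of the graphs `B i` whose image
is closed under exchanging a coordinate of one vertex for that of another. -/
structure IsCoordinatization {W ι : Type*} [DecidableEq ι] {F : ι → Type*} (H : SimpleGraph W)
    (B : ∀ i, SimpleGraph (F i)) (φ : W → ∀ i, F i) : Prop where
  injective : Function.Injective φ
  adjOrEq : ∀ x y, AdjOrEq H x y ↔ ∀ i, AdjOrEq (B i) (φ x i) (φ y i)
  exists_update : ∀ x y i, ∃ z, φ z = Function.update (φ x) i (φ y i)

/-- The maps `α` and `β` are the projections of a strong product with two factors onto the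
two fibers through `u`. -/
structure IsSplitting {W : Type*} (H : SimpleGraph W) (u : W) (α β : W → W) : Prop where
  adjOrEq : ∀ x y, AdjOrEq H x y ↔ AdjOrEq H (α x) (α y) ∧ AdjOrEq H (β x) (β y)
  left_left : ∀ x, α (α x) = α x
  left_right : ∀ x, α (β x) = u
  right_left : ∀ x, β (α x) = u
  right_right : ∀ x, β (β x) = β x
  ext : ∀ x y, α x = α y → β x = β y → x = y
  exists_mix : ∀ x y, ∃ z, α z = α x ∧ β z = β y

/-! ### Splittings and the order by reverse inclusion of closed neighborhoods. -/

namespace IsSplitting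

variable {W : Type*} {H : SimpleGraph W} {u : W} {α β γ δ : W → W}

theorem swap (h : IsSplitting H u α β) : IsSplitting H u β α where
  adjOrEq x y := (h.adjOrEq x y).trans and_comm
  left_left := h.right_right
  left_right := h.right_left
  right_left := h.left_right
  right_right := h.left_left
  ext x y hβ hα := h.ext x y hα hβ
  exists_mix x y := (h.exists_mix y x).imp fun _ t => t.symm

/-- The order on the vertices by reverse inclusion of closed neighborhoods; a universal vertex is
its least element. -/
def NbhdLE (H : SimpleGraph W) (x y : W) : Prop := ∀ z, AdjOrEq H z y → AdjOrEq H z x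

theorem NbhdLE.antisymm (hH : IsThin H) {x y : W} (h : NbhdLE H x y) (h' : NbhdLE H y x) :
    x = y :=
  hH.eq fun z => ⟨fun t => (h' z t.symm).symm, fun t => (h z t.symm).symm⟩

theorem left_le (h : IsSplitting H u α β) (hu : ∀ z, AdjOrEq H z u) (x : W) :
    NbhdLE H (α x) x := by
  intro z hz
  rw [h.adjOrEq, h.left_left, h.right_left]
  exact ⟨((h.adjOrEq z x).1 hz).1, hu _⟩

/-- On the fiber of `α` the second projection is the universal vertex `u`, so only first projections
matter: replacing a neighbor `z` of `α y` by `α z` yields a neighbor of `y`, to which the hypothesis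
applies. -/
theorem left_mono (h : IsSplitting H u α β) (hu : ∀ z, AdjOrEq H z u) {x y : W}
    (hxy : NbhdLE H x y) : NbhdLE H (α x) (α y) := by
  intro z hz
  have h1 : AdjOrEq H (α z) (α y) := by
    have := ((h.adjOrEq z (α y)).1 hz).1
    rwa [h.left_left] at this
  have h2 : AdjOrEq H (α z) y := by
    rw [h.adjOrEq, h.left_left, h.right_left]
    exact ⟨h1, (hu _).symm⟩
  have h3 := ((h.adjOrEq _ _).1 (hxy _ h2)).1
  rw [h.left_left] at h3
  rw [h.adjOrEq, h.left_left, h.right_left]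
  exact ⟨h3, hu _⟩

theorem right_base (h : IsSplitting H u α β) : β u = u := by
  rw [← h.right_left u, h.right_right]

theorem left_eq_self_iff (h : IsSplitting H u α β) {x : W} : α x = x ↔ β x = u := by
  constructor
  · intro hx
    rw [← hx, h.right_left]
  · intro hx
    exact h.ext _ _ (h.left_left x) (by rw [h.right_left, hx])

theorem eq_base (h : IsSplitting H u α β) {x : W} (hα : α x = x) (hβ : β x = x) : x = u := by
  rw [← hβ, h.left_eq_self_iff.1 hα]

/-- Fibers through `u` are down-sets: `β` is monotone, so `β x` lies below `β y = u`, the least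
element. -/
theorem left_eq_self_of_le (h : IsSplitting H u α β) (hu : ∀ z, AdjOrEq H z u) (hH : IsThin H)
    {x y : W} (hxy : NbhdLE H x y) (hy : α y = y) : α x = x := by
  rw [h.left_eq_self_iff] at hy ⊢
  refine NbhdLE.antisymm hH ?_ fun z _ => hu z
  simpa only [hy] using h.swap.left_mono hu hxy

/-- If the fiber of `α` lies in the fiber of `δ`, the projection `γ` depends on `β` only. -/
theorem congr_of_subset (h : IsSplitting H u α β) (k : IsSplitting H u γ δ)
    (hu : ∀ z, AdjOrEq H z u) (hH : IsThin H) (hsub : ∀ x, α x = x → δ x = x) {x y : W}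
    (hxy : β x = β y) : γ x = γ y := by
  have key : ∀ x, γ x = γ (β x) := by
    intro x
    -- This vertex lies below `γ x`, hence in the fiber of `γ`; it also lies in the fiber of `α`,
    -- hence of `δ`. These two fibers meet only in `u`.
    have h1 : α (γ x) = u :=
      k.eq_base (k.left_eq_self_of_le hu hH (h.left_le hu _) (k.left_left x))
        (hsub _ (h.left_left _))
    have h2 : β (γ x) = γ x := h.swap.left_eq_self_iff.2 h1
    -- Applying `β` to `γ x ≤ x` fixes the left side. Applying `γ` then squeezes: `γ x ≤ γ (β x) ≤ γ
    -- x`.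
    have h3 : NbhdLE H (γ x) (β x) := by
      have := h.swap.left_mono hu (k.left_le hu x)
      rwa [h2] at this
    have h4 := k.left_mono hu h3
    rw [k.left_left] at h4
    exact NbhdLE.antisymm hH h4 (k.left_mono hu (h.swap.left_le hu x))
  rw [key x, key y, hxy]

/-- Two fibers through `u` that meet in `u` only lie in complementary fibers. -/
theorem right_eq_self_of_subset (h : IsSplitting H u α β) (k : IsSplitting H u γ δ)
    (hu : ∀ z, AdjOrEq H z u) (hH : IsThin H) (hsub : ∀ x, α x = x → γ x = x) {x : W}
    (hx : δ x = x) : β x = x :=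
  h.swap.left_eq_self_iff.2 <|
    k.eq_base (hsub _ (h.left_left _)) (k.swap.left_eq_self_of_le hu hH (h.left_le hu x) hx)

end IsSplitting

/-- The fiber of `α` is the strong product of its intersections with the fibers of `γ`, `δ`. -/
theorem IsSplitting.nonempty_iso_strongProd {W : Type u} {H : SimpleGraph W} {u : W}
    {α β γ δ : W → W} (h : IsSplitting H u α β) (k : IsSplitting H u γ δ)
    (hu : ∀ z, AdjOrEq H z u) (hH : IsThin H) :
    Nonempty (H.induce {x | α x = x} ≃g
      strongProd (H.induce {x | α x = x ∧ γ x = x}) (H.induce {x | α x = x ∧ δ x = x})) := by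
  let m : {x | α x = x} → {x | α x = x ∧ γ x = x} × {x | α x = x ∧ δ x = x} := fun x =>
    (⟨γ x, h.left_eq_self_of_le hu hH (k.left_le hu _) x.2, k.left_left _⟩,
      ⟨δ x, h.left_eq_self_of_le hu hH (k.swap.left_le hu _) x.2, k.right_right _⟩)
  have minj : Function.Injective m := by
    intro x y hxy
    have h1 : γ (x : W) = γ (y : W) := congrArg (fun t => (t.1 : W)) hxy
    have h2 : δ (x : W) = δ (y : W) := congrArg (fun t => (t.2 : W)) hxy
    exact Subtype.ext (k.ext _ _ h1 h2)
  have msurj : Function.Surjective m := by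
    rintro ⟨⟨c, hc, hc'⟩, ⟨d, hd, hd'⟩⟩
    obtain ⟨x, hx, hx'⟩ := k.exists_mix c d
    rw [hc'] at hx
    rw [hd'] at hx'
    -- Surjectivity requires the mixed vertex `x` to lie in the fiber of `α`, i.e. `β x = u`. Both
    -- projections of `β x` lie below it, hence in the fiber of `β`, and below `c` or `d`, hence in
    -- the fiber of `α`; so both are `u`.
    have hβ : ∀ z, α z = z → NbhdLE H (γ (β x)) z → γ (β x) = u := fun z hz hle =>
      h.eq_base (h.left_eq_self_of_le hu hH hle hz)
        (h.swap.left_eq_self_of_le hu hH (k.left_le hu _) (h.right_right x))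
    have hβ' : ∀ z, α z = z → NbhdLE H (δ (β x)) z → δ (β x) = u := fun z hz hle =>
      h.eq_base (h.left_eq_self_of_le hu hH hle hz)
        (h.swap.left_eq_self_of_le hu hH (k.swap.left_le hu _) (h.right_right x))
    have h1 : γ (β x) = u := hβ c hc (hx ▸ k.left_mono hu (h.swap.left_le hu x))
    have h2 : δ (β x) = u := hβ' d hd (hx' ▸ k.swap.left_mono hu (h.swap.left_le hu x))
    have h3 : β x = u := k.ext _ _ (by rw [h1, k.swap.right_base]) (by rw [h2, k.right_base])
    exact ⟨⟨x, h.left_eq_self_iff.2 h3⟩, Prod.ext (Subtype.ext hx) (Subtype.ext hx')⟩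
  have mbij : Function.Bijective m := ⟨minj, msurj⟩
  refine ⟨⟨Equiv.ofBijective m mbij, ?_⟩⟩
  intro x y
  have h1 : (strongProd (H.induce {x | α x = x ∧ γ x = x})
      (H.induce {x | α x = x ∧ δ x = x})).Adj (m x) (m y) ↔
      m x ≠ m y ∧ AdjOrEq (H.induce {x | α x = x ∧ γ x = x}) (m x).1 (m y).1 ∧
        AdjOrEq (H.induce {x | α x = x ∧ δ x = x}) (m x).2 (m y).2 := Iff.rfl
  have h2 : AdjOrEq H (x : W) y ↔ AdjOrEq H (γ x) (γ y) ∧ AdjOrEq H (δ x) (δ y) :=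
    k.adjOrEq _ _
  rw [Equiv.ofBijective_apply, Equiv.ofBijective_apply, h1, minj.ne_iff, adjOrEq_induce,
    adjOrEq_induce, adj_iff_ne_and_adjOrEq, adjOrEq_induce, h2]

/-- The projections onto the `i`-th fiber through `u` and onto the complementary fiber. -/
theorem IsCoordinatization.exists_isSplitting {W ι : Type*} [DecidableEq ι] {F : ι → Type*}
    {H : SimpleGraph W} {B : ∀ i, SimpleGraph (F i)} {φ : W → ∀ i, F i}
    (h : IsCoordinatization H B φ) (u : W) (i : ι) :
    ∃ α β : W → W, IsSplitting H u α β ∧ (∀ x, φ (α x) = Function.update (φ u) i (φ x i)) ∧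
      ∀ x, φ (β x) = Function.update (φ x) i (φ u i) := by
  choose α hα using fun x => h.exists_update u x i
  choose β hβ using fun x => h.exists_update x u i
  have hαi : ∀ x, φ (α x) i = φ x i := fun x => by simp [hα]
  have hαj : ∀ x j, j ≠ i → φ (α x) j = φ u j := fun x j hj => by simp [hα, hj]
  have hβi : ∀ x, φ (β x) i = φ u i := fun x => by simp [hβ]
  have hβj : ∀ x j, j ≠ i → φ (β x) j = φ x j := fun x j hj => by simp [hβ, hj]
  have ext : ∀ x y, φ x i = φ y i → (∀ j, j ≠ i → φ x j = φ y j) → x = y := by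
    intro x y h1 h2
    apply h.injective
    funext j
    by_cases hj : j = i
    · subst hj; exact h1
    · exact h2 j hj
  refine ⟨α, β, ⟨?_, ?_, ?_, ?_, ?_, ?_, ?_⟩, hα, hβ⟩
  · intro x y
    rw [h.adjOrEq, h.adjOrEq, h.adjOrEq]
    constructor
    · refine fun t => ⟨fun j => ?_, fun j => ?_⟩ <;> by_cases hj : j = i
      · subst hj; rw [hαi, hαi]; exact t _
      · rw [hαj _ _ hj, hαj _ _ hj]; exact .refl _ _
      · subst hj; rw [hβi, hβi]; exact .refl _ _
      · rw [hβj _ _ hj, hβj _ _ hj]; exact t _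
    · rintro ⟨t1, t2⟩ j
      by_cases hj : j = i
      · subst hj; simpa only [hαi] using t1 j
      · simpa only [hβj _ _ hj] using t2 j
  · exact fun x => ext _ _ (by rw [hαi]) fun j hj => by rw [hαj _ _ hj, hαj _ _ hj]
  · exact fun x => ext _ _ (by rw [hαi, hβi]) fun j hj => by rw [hαj _ _ hj]
  · exact fun x => ext _ _ (by rw [hβi]) fun j hj => by rw [hβj _ _ hj, hαj _ _ hj]
  · exact fun x => ext _ _ (by rw [hβi, hβi]) fun j hj => by rw [hβj _ _ hj]
  · intro x y h1 h2
    refine ext _ _ ?_ fun j hj => ?_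
    · rw [← hαi x, h1, hαi]
    · rw [← hβj x j hj, h2, hβj _ _ hj]
  · intro x y
    obtain ⟨z, hz⟩ := h.exists_update y x i
    refine ⟨z, ext _ _ ?_ fun j hj => ?_, ext _ _ ?_ fun j hj => ?_⟩
    · rw [hαi, hαi, hz]; simp
    · rw [hαj _ _ hj, hαj _ _ hj]
    · rw [hβi, hβi]
    · rw [hβj _ _ hj, hβj _ _ hj, hz]; simp [hj]

/-- Strict refinement: in a thin graph with a universal vertex, every prime factor of a
coordinatization lies in a factor of any other coordinatization. -/
theorem IsCoordinatization.exists_factor {W : Type u} {ι κ : Type*} [DecidableEq ι]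
    [DecidableEq κ] {F : ι → Type u} {E : κ → Type*} {H : SimpleGraph W}
    {B : ∀ i, SimpleGraph (F i)} {D : ∀ l, SimpleGraph (E l)} {φ : W → ∀ i, F i}
    {ψ : W → ∀ l, E l} (hφ : IsCoordinatization H B φ) (hψ : IsCoordinatization H D ψ)
    (hH : IsThin H) {u : W} (hu : ∀ z, AdjOrEq H z u) (i : ι) (hi : IsPrimeGraph (B i))
    (hsurj : ∀ t, ∃ x, φ x i = t) :
    ∃ l, (∀ x y, φ x i ≠ φ y i → ψ x l ≠ ψ y l) ∧
      ∀ x y, (∀ j, j ≠ i → φ x j = φ y j) → ∀ m, m ≠ l → ψ x m = ψ y m := by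
  obtain ⟨α, β, h, hα, hβ⟩ := hφ.exists_isSplitting u i
  choose γ δ k hγ hδ using fun l => hψ.exists_isSplitting u l
  let m : {x | α x = x} → F i := fun x => φ x i
  have mbij : Function.Bijective m := by
    constructor
    · rintro ⟨x, hx : α x = x⟩ ⟨y, hy : α y = y⟩ (hxy : φ x i = φ y i)
      refine Subtype.ext (?_ : x = y)
      rw [← hx, ← hy]
      exact hφ.injective (by rw [hα, hα, hxy])
    · intro t
      obtain ⟨x, hx⟩ := hsurj t
      exact ⟨⟨α x, h.left_left x⟩, by simp [m, hα, hx]⟩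
  -- The fiber through `u` is a copy of the factor, so primality of `B i` can be applied to its
  -- product decompositions.
  let iso : H.induce {x | α x = x} ≃g B i := ⟨Equiv.ofBijective m mbij, by
    rintro ⟨x, hx : α x = x⟩ ⟨y, hy : α y = y⟩
    have key : AdjOrEq H x y ↔ AdjOrEq (B i) (φ x i) (φ y i) := by
      rw [hφ.adjOrEq]
      refine ⟨fun t => t i, fun t j => ?_⟩
      by_cases hj : j = i
      · subst hj; exact t
      · rw [← hx, ← hy, hα, hα]
        simpa [hj] using AdjOrEq.refl _ _
    rw [Equiv.ofBijective_apply, Equiv.ofBijective_apply, adj_iff_ne_and_adjOrEq, mbij.1.ne_iff,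
      adj_iff_ne_and_adjOrEq, adjOrEq_induce]
    exact and_congr_right fun _ => key.symm⟩
  have ntA : ∃ x, α x = x ∧ x ≠ u := by
    have := hi.1
    obtain ⟨t, ht⟩ := exists_ne (φ u i)
    obtain ⟨x, rfl⟩ := hsurj t
    refine ⟨α x, h.left_left x, fun hx => ht ?_⟩
    rw [← hx, hα]; simp
  have hαu : α u = u := h.swap.right_base
  have dich : ∀ l, (∀ x, α x = x → δ l x = x) ∨ ∀ x, α x = x → γ l x = x := by
    intro l
    obtain ⟨j⟩ := h.nonempty_iso_strongProd (k l) hu hH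
    have hγu : γ l u = u := (k l).swap.right_base
    have hδu : δ l u = u := (k l).right_base
    rcases hi.2 _ _ _ _ ⟨iso.symm.trans j⟩ with hs | hs
    · left
      intro x hx
      have := hs.elim ⟨γ l x, h.left_eq_self_of_le hu hH ((k l).left_le hu _) hx,
        (k l).left_left _⟩ ⟨u, hαu, hγu⟩
      exact (k l).swap.left_eq_self_iff.2 (congrArg Subtype.val this)
    · right
      intro x hx
      have := hs.elim ⟨δ l x, h.left_eq_self_of_le hu hH ((k l).swap.left_le hu _) hx,
        (k l).right_right _⟩ ⟨u, hαu, hδu⟩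
      exact (k l).left_eq_self_iff.2 (congrArg Subtype.val this)
  -- If the fiber lay in the complementary fiber for every `l`, all its vertices would share every
  -- coordinate with `u`, contradicting nontriviality.
  obtain ⟨l, hl⟩ : ∃ l, ∀ x, α x = x → γ l x = x := by
    by_contra! hcon
    obtain ⟨x, hx, hxu⟩ := ntA
    refine hxu (hψ.injective (funext fun l => ?_))
    have hd : ∀ x, α x = x → δ l x = x := (dich l).resolve_right fun t => by
      obtain ⟨z, hz, hz'⟩ := hcon l
      exact hz' (t z hz)
    rw [← hd x hx, hδ]; simp
  refine ⟨l, fun x y hxy hne => hxy ?_, fun x y hxy n hn => ?_⟩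
  -- Contrapositive: since the fiber of `α` lies in that of `γ l`, the fiber of `δ l` lies in that
  -- of `β`, so `α` depends on `γ l` only.
  · have h1 : γ l x = γ l y := hψ.injective (by rw [hγ, hγ, hne])
    have h2 : α x = α y := (k l).swap.congr_of_subset h hu hH
      (fun z hz => h.right_eq_self_of_subset (k l) hu hH hl hz) h1
    have h3 := congrArg (fun z => φ z i) h2
    simpa [hα] using h3
  -- For `n ≠ l` the fiber of `γ l` lies in that of `δ n`, so `γ n` depends on `β` only.
  · have hd : ∀ z, α z = z → δ n z = z := by
      intro z hz
      rw [(k n).swap.left_eq_self_iff]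
      refine hψ.injective ?_
      rw [hγ, ← hl z hz, hγ]
      simp [hn]
    have h1 : β x = β y := by
      refine hφ.injective ?_
      rw [hβ, hβ]
      funext j
      by_cases hj : j = i
      · subst hj; simp
      · simpa [hj] using hxy j hj
    have h2 := congrArg (fun z => ψ z n) (h.congr_of_subset (k n) hu hH hd h1)
    simpa [hγ] using h2

/-! ### Restricting the factorization of `G` to closed neighborhoods. -/

theorem PFD.isCoordinatization {W : Type u} {G : SimpleGraph W} (p : PFD G) :
    IsCoordinatization G p.graph p.iso where
  injective := p.iso.injective
  adjOrEq x y := by rw [adjOrEq_iso p.iso, adjOrEq_strongProdFamily]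
  exists_update x y i := p.iso.surjective _

/-- A closed neighborhood is a subproduct of every coordinatization of the graph. -/
theorem IsCoordinatization.nbhdGraph {W ι : Type*} [DecidableEq ι] {F : ι → Type*}
    {G : SimpleGraph W} {B : ∀ i, SimpleGraph (F i)} {φ : W → ∀ i, F i}
    (h : IsCoordinatization G B φ) (v : W) :
    IsCoordinatization (nbhdGraph G v) B fun x => φ x where
  injective := h.injective.comp Subtype.val_injective
  adjOrEq x y := by rw [adjOrEq_induce, h.adjOrEq]
  exists_update x y i := by
    obtain ⟨z, hz⟩ := h.exists_update x y i
    -- The exchanged vertex stays in `N[v]`: each of its coordinates comes from a vertex of `N[v]`,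
    -- and adjacency is tested coordinatewise.
    refine ⟨⟨z, mem_closedNbhd_iff.2 ((h.adjOrEq _ _).2 fun j => ?_)⟩, hz⟩
    have hx := (h.adjOrEq _ _).1 (mem_closedNbhd_iff.1 x.2)
    have hy := (h.adjOrEq _ _).1 (mem_closedNbhd_iff.1 y.2)
    rw [hz]
    by_cases hj : j = i
    · subst hj; simpa using hy j
    · simpa [hj] using hx j

theorem adjOrEq_nbhdGraph_center {W : Type*} (G : SimpleGraph W) (v : W) (z : closedNbhd G v) :
    AdjOrEq (nbhdGraph G v) z ⟨v, self_mem_closedNbhd G v⟩ :=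
  adjOrEq_induce.2 (mem_closedNbhd_iff.1 z.2).symm

theorem PFD.exists_factor_nbhdGraph {W : Type u} {G : SimpleGraph W} (q : PFD G) {v : W}
    (p : PFD (nbhdGraph G v)) (hthin : IsThin (nbhdGraph G v)) (i : Fin p.n) :
    ∃ l, (∀ x y : closedNbhd G v, p.iso x i ≠ p.iso y i → q.iso x l ≠ q.iso y l) ∧
      ∀ x y : closedNbhd G v, (∀ j, j ≠ i → p.iso x j = p.iso y j) →
        ∀ m, m ≠ l → q.iso x m = q.iso y m := by
  refine p.isCoordinatization.exists_factor (q.isCoordinatization.nbhdGraph v) hthin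
    (adjOrEq_nbhdGraph_center G v) i (p.prime i) fun t => ?_
  obtain ⟨x, hx⟩ := p.iso.surjective
    (Function.update (p.iso ⟨v, self_mem_closedNbhd G v⟩) i t)
  exact ⟨x, by rw [hx]; simp⟩

end Refinement

/-! ### Local colorings of thin neighborhoods -/

section LocalColoring

variable {V : Type u} {G : SimpleGraph V}

theorem ncard_sClass_eq_one {U : Set V} (hthin : IsThin (G.induce U)) (a : U) :
    (sClass G U a).ncard = 1 := by
  rw [Set.ncard_eq_one]
  refine ⟨a, Set.eq_singleton_iff_unique_mem.2 ⟨⟨a.2, rfl⟩, ?_⟩⟩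
  rintro w ⟨hw, hwa⟩
  have : (⟨w, hw⟩ : U) = a := hthin.eq fun z => by
    have := Set.ext_iff.1 hwa z
    simpa only [Set.mem_inter_iff, z.2, and_true, mem_closedNbhd_iff, adjOrEq_induce] using this
  exact congrArg Subtype.val this

theorem localColoring_of_isCartesian {U : Set V} (hthin : IsThin (G.induce U))
    {p : PFD (G.induce U)} {a b : U} {i : Fin p.n} (h : p.IsCartesian s(a, b) i) :
    localColoring G p s((a : V), (b : V)) = some i :=
  localColoring_eq_some_iff.2 ⟨a, b, rfl, h, Or.inl (ncard_sClass_eq_one hthin a)⟩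

/-- Every vertex of a closed neighborhood is on Cartesian edges of all factors. -/
theorem exists_isCartesian {v : V} (p : PFD (nbhdGraph G v)) (y : closedNbhd G v)
    (i : Fin p.n) : ∃ w, p.IsCartesian s(y, w) i := by
  set u : closedNbhd G v := ⟨v, self_mem_closedNbhd G v⟩
  have hu : ∀ z j, AdjOrEq (p.graph j) (p.iso z j) (p.iso u j) := fun z =>
    (p.isCoordinatization.adjOrEq _ _).1 (adjOrEq_nbhdGraph_center G v z)
  have key : ∀ t, t ≠ p.iso y i → AdjOrEq (p.graph i) (p.iso y i) t →
      ∃ w, p.IsCartesian s(y, w) i := by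
    intro t ht hadj
    obtain ⟨w, hw⟩ := p.iso.surjective (Function.update (p.iso y) i t)
    have hwi : p.iso w i = t := by rw [hw]; simp
    have hwj : ∀ j, j ≠ i → p.iso w j = p.iso y j := fun j hj => by rw [hw]; simp [hj]
    refine ⟨w, y, w, rfl, adj_iff_ne_and_adjOrEq.2 ⟨?_, ?_⟩, fun j => ⟨?_, ?_⟩⟩
    · rintro rfl
      exact ht hwi.symm
    · rw [p.isCoordinatization.adjOrEq]
      intro j
      by_cases hj : j = i
      · subst hj; rwa [hwi]
      · rw [hwj j hj]; exact .refl _ _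
    · intro hne
      by_contra hj
      exact hne (hwj j hj).symm
    · rintro rfl
      rw [hwi]
      exact ht.symm
  -- The `i`-th coordinate of the center is universal in its factor. If `y` has that coordinate, any
  -- other value serves as `t`; otherwise move to the coordinate of the center itself.
  by_cases hy : p.iso u i = p.iso y i
  · have := (p.prime i).1
    obtain ⟨t, ht⟩ := exists_ne (p.iso y i)
    refine key t ht ?_
    obtain ⟨w, hw⟩ := p.iso.surjective (Function.update (p.iso u) i t)
    have hwi : p.iso w i = t := by rw [hw]; simp
    rw [← hy, ← hwi]
    exact (hu w i).symm
  · exact key _ hy (hu y i)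

theorem exists_localColoring_eq {v : V} (hthin : IsThin (nbhdGraph G v))
    (p : PFD (nbhdGraph G v)) (y : closedNbhd G v) (i : Fin p.n) :
    ∃ w, localColoring G p s((y : V), w) = some i := by
  obtain ⟨w, hw⟩ := exists_isCartesian p y i
  exact ⟨w, localColoring_of_isCartesian hthin hw⟩

/-- The local coloring of a thin neighborhood is at least as fine as the product coloring. -/
theorem exists_isCartesian_of_localColoring (q : PFD G) {v : V} (p : PFD (nbhdGraph G v))
    (hthin : IsThin (nbhdGraph G v)) (i : Fin p.n) :
    ∃ l, (∀ x y : closedNbhd G v, p.iso x i ≠ p.iso y i → q.iso x l ≠ q.iso y l) ∧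
      ∀ e, localColoring G p e = some i → q.IsCartesian e l := by
  obtain ⟨l, h1, h2⟩ := q.exists_factor_nbhdGraph p hthin i
  refine ⟨l, h1, fun e he => ?_⟩
  obtain ⟨a, b, rfl, ⟨a', b', hab, hadj, hc⟩, -⟩ := localColoring_eq_some_iff.1 he
  refine ⟨a', b', ?_, hadj, fun m => ⟨fun hm => ?_, ?_⟩⟩
  · simpa using congrArg (Sym2.map Subtype.val) hab
  · by_contra hml
    exact hm (h2 a' b' (fun j hj => by_contra fun t => hj ((hc j).1 t)) m hml)
  · rintro rfl
    exact h1 _ _ ((hc i).2 rfl)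

end LocalColoring

/-! ### Colorings that refine the product coloring -/

section Fine

variable {V : Type u} {G : SimpleGraph V} {κ μ : Type*}

/-- The map `T` assigns to each color in use the factor of `q` that contains its edges. -/
def FactorMap (q : PFD G) (f : Sym2 V → Option κ) (T : κ → Option (Fin q.n)) : Prop :=
  ∀ e k, f e = some k → ∃ l, T k = some l ∧ q.IsCartesian e l

theorem FactorMap.eq_some {q : PFD G} {f : Sym2 V → Option κ} {T : κ → Option (Fin q.n)}
    (h : FactorMap q f T) {e : Sym2 V} {k : κ} {l : Fin q.n} (he : f e = some k)
    (hl : q.IsCartesian e l) : T k = some l := by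
  obtain ⟨l', hT, hl'⟩ := h e k he
  rw [hT, hl'.unique hl]

theorem FactorMap.fine {q : PFD G} {f : Sym2 V → Option κ} {T : κ → Option (Fin q.n)}
    (h : FactorMap q f T) {e e' : Sym2 V} {k : κ} (he : f e = some k) (he' : f e' = some k) :
    ∃ l, q.IsCartesian e l ∧ q.IsCartesian e' l := by
  obtain ⟨l, hT, hl⟩ := h e k he
  obtain ⟨l', hT', hl'⟩ := h e' k he'
  rw [hT] at hT'
  cases hT'
  exact ⟨l, hl, hl'⟩

open Classical in
-- Recasting pairwise fineness as a function on colors lets it pass to quotients: it only has to be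
-- constant on generating pairs. Colors not in use get the value `none`.
theorem exists_factorMap {q : PFD G} {f : Sym2 V → Option κ}
    (h : ∀ e e' k, f e = some k → f e' = some k → ∃ l, q.IsCartesian e l ∧ q.IsCartesian e' l) :
    ∃ T, FactorMap q f T := by
  refine ⟨fun k => if t : ∃ l e, f e = some k ∧ q.IsCartesian e l then some t.choose else none,
    fun e k he => ?_⟩
  obtain ⟨l, hl, -⟩ := h e e k he he
  have t : ∃ l e, f e = some k ∧ q.IsCartesian e l := ⟨l, e, he, hl⟩
  refine ⟨t.choose, dif_pos t, ?_⟩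
  obtain ⟨e', he', hl'⟩ := t.choose_spec
  obtain ⟨l', h1, h2⟩ := h e' e k he' he
  exact hl'.unique h1 ▸ h2

/-- A Cartesian edge determines its factor, so `T` and `S` agree on any two colors identified
through a common edge. -/
theorem FactorMap.exists_combinedColoring {q : PFD G} {f : Sym2 V → Option κ}
    {g : Sym2 V → Option μ} {T : κ → Option (Fin q.n)} {S : μ → Option (Fin q.n)}
    (hT : FactorMap q f T) (hS : FactorMap q g S) :
    ∃ R, FactorMap q (combinedColoring f g) R := by
  refine ⟨Quot.lift (Sum.elim T S) ?_, fun e k he => ?_⟩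
  · rintro _ _ ⟨e, k, c, hf, hg⟩
    obtain ⟨l, hk, hl⟩ := hT e k hf
    exact hk.trans (hS.eq_some hg hl).symm
  · unfold combinedColoring at he
    cases hf : f e with
    | some k' =>
      rw [hf] at he
      cases he
      exact hT e k' hf
    | none =>
      cases hg : g e with
      | some c =>
        rw [hf, hg] at he
        cases he
        exact hS e c hg
      | none =>
        rw [hf, hg] at he
        cases he

/-- Merging is harmless when each `D_c` stays within the factor of `G` containing `e_c`; this also
makes the new color of `e_c` correct. -/
theorem FactorMap.exists_mergedColoring {q : PFD G} {f : Sym2 V → Option κ}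
    {T : κ → Option (Fin q.n)} (hT : FactorMap q f T) {x : V} {p : PFD (nbhdGraph G x)}
    {C : Set μ} {rep : μ → V}
    (h : ∀ c ∈ C, ∃ l, q.IsCartesian s(x, rep c) l ∧
      ∀ k ∈ differingColors G f x p (rep c), T k = some l) :
    ∃ R, FactorMap q (mergedColoring G f x p C rep) R := by
  refine ⟨Quot.lift T ?_, fun e k he => ?_⟩
  · rintro k k' ⟨c, hc, hk, hk'⟩
    obtain ⟨l, -, hl⟩ := h c hc
    rw [hl k hk, hl k' hk']
  · unfold mergedColoring at he
    cases hf : f e with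
    | some k' =>
      rw [hf] at he
      cases he
      exact hT e k' hf
    | none =>
      rw [hf] at he
      dsimp only at he
      split_ifs at he with t
      cases he
      obtain ⟨c, hc, hec, hk⟩ := t.choose_spec
      obtain ⟨l, hl, hkl⟩ := h c hc
      exact ⟨l, hkl _ hk, by rw [hec]; exact hl⟩

/-! ### Domains and values of the combined and merged colorings. -/

theorem combinedColoring_ne_none_iff {f : Sym2 V → Option κ} {g : Sym2 V → Option μ}
    {e : Sym2 V} : combinedColoring f g e ≠ none ↔ f e ≠ none ∨ g e ≠ none := by
  unfold combinedColoring
  cases f e <;> simp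

theorem combinedColoring_congr_left {f : Sym2 V → Option κ} {g : Sym2 V → Option μ}
    {e e' : Sym2 V} (h : f e = f e') (he : f e ≠ none) :
    combinedColoring f g e = combinedColoring f g e' := by
  obtain ⟨k, hk⟩ := Option.ne_none_iff_exists'.1 he
  simp [combinedColoring, ← h, hk]

theorem combinedColoring_of_right {f : Sym2 V → Option κ} {g : Sym2 V → Option μ}
    {e : Sym2 V} {c : μ} (hg : g e = some c) :
    combinedColoring f g e = some (Quot.mk _ (Sum.inr c)) := by
  unfold combinedColoring
  cases hf : f e with
  | none => simp [hg]
  | some k => exact congrArg some (Quot.sound ⟨e, k, c, hf, hg⟩)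

theorem mergedColoring_of_eq_some {f : Sym2 V → Option κ} {x : V} {p : PFD (nbhdGraph G x)}
    {C : Set μ} {rep : μ → V} {e : Sym2 V} {k : κ} (h : f e = some k) :
    mergedColoring G f x p C rep e = some (Quot.mk _ k) := by
  simp [mergedColoring, h]

theorem mergedColoring_ne_none_iff {f : Sym2 V → Option κ} {x : V} {p : PFD (nbhdGraph G x)}
    {C : Set μ} {rep : μ → V} {e : Sym2 V} :
    mergedColoring G f x p C rep e ≠ none ↔ f e ≠ none ∨
      ∃ k, ∃ c ∈ C, e = s(x, rep c) ∧ k ∈ differingColors G f x p (rep c) := by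
  unfold mergedColoring
  cases hf : f e with
  | some k => simp
  | none =>
    dsimp only
    split_ifs with t
    · simpa using t
    · simpa using t

/-- All coordinates of a thin neighborhood have a color, hence every vertex other than the center
differs from it in some color. -/
theorem differingColors_nonempty {q : PFD G} {P : ∀ w, PFD (nbhdGraph G w)} {L : List V}
    {f : Sym2 V → Option κ} (hf : IsProperCombined G q P L f) {x w : V} (hx : x ∈ L)
    (hthin : IsThin (nbhdGraph G x)) (hw : G.Adj x w) :
    (differingColors G f x (P x) w).Nonempty := by
  have hwx : w ∈ closedNbhd G x := mem_closedNbhd_iff.2 (Or.inr hw)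
  have hne : (P x).iso ⟨x, self_mem_closedNbhd G x⟩ ≠ (P x).iso ⟨w, hwx⟩ := fun h =>
    hw.ne (congrArg Subtype.val ((P x).iso.injective h))
  obtain ⟨i, hi⟩ := Function.ne_iff.1 hne
  obtain ⟨y, hy⟩ := exists_localColoring_eq hthin (P x) ⟨x, self_mem_closedNbhd G x⟩ i
  obtain ⟨k, hk⟩ := Option.ne_none_iff_exists'.1
    ((hf.domain _).2 ⟨x, hx, by rw [hy]; exact Option.some_ne_none i⟩)
  exact ⟨k, hwx, i, hi, _, hy, hk⟩

end Fine

end StrongPFD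

/-! ### Correctness of the algorithm. -/

theorem mainTheorem4 {V : Type u} [Finite V] (G : SimpleGraph V)
    (hconn : G.Connected) (hthin : StrongPFD.IsThin G)
    -- a prime factor decomposition of `G` and one of each neighbourhood
    (q : StrongPFD.PFD G) (P : ∀ w : V, StrongPFD.PFD (StrongPFD.nbhdGraph G w))
    -- the BFS-ordered backbone; `L[i]` is the current vertex, `L.take i` lists the earlier ones
    (L : List V) (hL : StrongPFD.IsBFSOrder G (StrongPFD.backbone G) L)
    (i : ℕ) (hi : i < L.length)
    (x : V) (hx : StrongPFD.IsBFSParent G L i hi x)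
    (hthin_i : StrongPFD.IsThin (StrongPFD.nbhdGraph G L[i]))
    (hthin_x : StrongPFD.IsThin (StrongPFD.nbhdGraph G x))
    -- the proper combined coloring of `H`
    {κ : Type v} (f : Sym2 V → Option κ)
    (hf : StrongPFD.IsProperCombined G q P (L.take i) f)
    -- the colors for which the color-continuation from `H` to `⟨N[L[i]]⟩` fails
    (C : Set (Fin (P L[i]).n))
    (hC : C = StrongPFD.failingColors f (StrongPFD.localColoring G (P L[i]))) :
    -- the algorithm finds a representative for each color in `C` ...
    (∀ c ∈ C, ∃ w : V, StrongPFD.localColoring G (P L[i]) s(x, w) = some c) ∧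
    -- ... and works for every choice of representatives
    ∀ rep : Fin (P L[i]).n → V,
      (∀ c ∈ C, StrongPFD.localColoring G (P L[i]) s(x, rep c) = some c) →
        StrongPFD.IsColorContinuation
          (StrongPFD.mergedColoring G f x (P x) C rep)
          (StrongPFD.localColoring G (P L[i])) ∧
        StrongPFD.IsProperCombined G q P (L.take (i + 1))
          (StrongPFD.solveColorContinuation G f
            (StrongPFD.localColoring G (P L[i])) x (P x) C rep) := by
  obtain ⟨n, hn, hnx, hadj, -⟩ := hx
  have hxL : x ∈ L.take i := hnx ▸ List.mem_take_iff_getElem.2 ⟨n, by omega, rfl⟩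
  have hxN : x ∈ StrongPFD.closedNbhd G L[i] :=
    StrongPFD.mem_closedNbhd_iff.2 (Or.inr hadj.symm)
  refine ⟨fun c _ => StrongPFD.exists_localColoring_eq hthin_i (P L[i]) ⟨x, hxN⟩ c,
    fun rep hrep => ?_⟩
  have fine_v := StrongPFD.exists_isCartesian_of_localColoring q (P L[i]) hthin_i
  have hrepAdj : ∀ c ∈ C, G.Adj x (rep c) := by
    intro c hc
    obtain ⟨l, -, hl⟩ := fine_v c
    obtain ⟨a, b, hab, hadj, -⟩ := hl _ (hrep c hc)
    exact (G.mem_edgeSet).1 (hab ▸ (G.mem_edgeSet).2 hadj)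
  have hcolored : ∀ c ∈ C,
      StrongPFD.mergedColoring G f x (P x) C rep s(x, rep c) ≠ none := by
    intro c hc
    obtain ⟨k, hk⟩ := StrongPFD.differingColors_nonempty hf hxL hthin_x (hrepAdj c hc)
    exact StrongPFD.mergedColoring_ne_none_iff.2 (Or.inr ⟨k, c, hc, rfl, hk⟩)
  obtain ⟨T, hT⟩ := StrongPFD.exists_factorMap hf.fine
  obtain ⟨T', hT'⟩ : ∃ R, StrongPFD.FactorMap q
      (StrongPFD.mergedColoring G f x (P x) C rep) R := by
    refine hT.exists_mergedColoring fun c hc => ?_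
    obtain ⟨l, -, hl⟩ := fine_v c
    have hcart := hl _ (hrep c hc)
    refine ⟨l, hcart, ?_⟩
    rintro k ⟨hw, j, hj, e, he, hk⟩
    obtain ⟨m, hm, hm'⟩ :=
      StrongPFD.exists_isCartesian_of_localColoring q (P x) hthin_x j
    have hdiff := hm _ _ hj
    -- The factor of `G` containing the `j`-th factor of `⟨N[x]⟩` separates `x` from `rep c`; but
    -- this edge is Cartesian, so its endpoints differ in coordinate `l` only.
    have hml : m = l := by
      obtain ⟨a, b, hab, -, h⟩ := hcart
      rcases Sym2.eq_iff.1 hab with ⟨h1, h2⟩ | ⟨h1, h2⟩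
      · exact (h m).1 (by rw [← h1, ← h2]; exact hdiff)
      · exact (h m).1 (by rw [← h1, ← h2]; exact hdiff.symm)
    exact hT.eq_some hk (hml ▸ hm' e he)
  obtain ⟨S, hS⟩ : ∃ S : Fin (P L[i]).n → Option (Fin q.n),
      StrongPFD.FactorMap q (StrongPFD.localColoring G (P L[i])) S :=
    StrongPFD.exists_factorMap fun e e' c he he' => by
      obtain ⟨l, -, hl⟩ := fine_v c
      exact ⟨l, hl e he, hl e' he'⟩
  obtain ⟨R, hR⟩ := hT'.exists_combinedColoring hS
  have hmem : ∀ w, w ∈ L.take (i + 1) ↔ w ∈ L.take i ∨ w = L[i] := by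
    intro w
    rw [← List.take_concat_get' L i hi, List.mem_append, List.mem_singleton]
  refine ⟨fun c ⟨e, he⟩ => ?_, ?_, ?_, fun e e' k he he' => hR.fine he he'⟩
  -- A failing color is now continued through its representative, any other color through an edge
  -- already colored by `f`.
  · by_cases hc : c ∈ C
    · exact ⟨_, hrep c hc, hcolored c hc⟩
    · have : ∃ e, StrongPFD.localColoring G (P L[i]) e = some c ∧ f e ≠ none := by
        by_contra! hcon
        exact hc (hC ▸ ⟨⟨e, he⟩, hcon⟩)
      obtain ⟨e', he', hfe'⟩ := this
      exact ⟨e', he', StrongPFD.mergedColoring_ne_none_iff.2 (Or.inl hfe')⟩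
  · intro e
    unfold StrongPFD.solveColorContinuation
    rw [StrongPFD.combinedColoring_ne_none_iff, StrongPFD.mergedColoring_ne_none_iff, hf.domain]
    constructor
    · rintro ((⟨w, hw, hwe⟩ | ⟨k, c, hc, rfl, -⟩) | hg)
      · exact ⟨w, (hmem w).2 (Or.inl hw), hwe⟩
      · exact ⟨L[i], (hmem _).2 (Or.inr rfl), by
          rw [hrep c hc]; exact Option.some_ne_none c⟩
      · exact ⟨L[i], (hmem _).2 (Or.inr rfl), hg⟩
    · rintro ⟨w, hw, hwe⟩
      rcases (hmem w).1 hw with hw | rfl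
      · exact Or.inl (Or.inl ⟨w, hw, hwe⟩)
      · exact Or.inr hwe
  · intro w hw e e' c he he'
    rcases (hmem w).1 hw with hw | rfl
    · have hfe := hf.compatible w hw e e' c he he'
      obtain ⟨k, hk⟩ := Option.ne_none_iff_exists'.1
        ((hf.domain e).2 ⟨w, hw, by rw [he]; exact Option.some_ne_none c⟩)
      have h1 := StrongPFD.mergedColoring_of_eq_some (p := P x) (C := C) (rep := rep) hk
      have h2 := StrongPFD.mergedColoring_of_eq_some (p := P x) (C := C) (rep := rep)
        (hfe ▸ hk)
      exact StrongPFD.combinedColoring_congr_left (h1.trans h2.symm)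
        (by rw [h1]; exact Option.some_ne_none _)
    · exact (StrongPFD.combinedColoring_of_right he).trans
        (StrongPFD.combinedColoring_of_right he').symm
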